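/- Let $F$ be a graph and let $H$ be a $k$-uniform hypergraph on a vertex set $V$ (a set of $k$-element subsets of $V$, called edges). We say that $H$ contains a Berge-$F$ if there are an injection $\psi\colon V(F)\to V$ and an injection $\varphi\colon E(F)\to E(H)$ such that $\{\psi(x),\psi(y)\}\subseteq\varphi(xy)$ for every edge $xy\in E(F)$. The hypergraph $H$ is Berge-$F$-saturated if it contains no Berge-$F$, but for every $k$-element set $e\subseteq V$ with $e\notin E(H)$ the hypergraph $H+e$ contains a Berge-$F$. Let $\mathrm{sat}_k(n,\text{Berge-}F)$ be the least number of edges in a Berge-$F$-saturated $k$-uniform hypergraph on $n$ vertices. Let $K_{1,\ell}$ be the star with $\ell$ leaves, and let $[n]=\{1,\dots,n\}$. **Theorem.** For all integers $k\ge 3$ and $\ell\ge 1$ there is $n_0=n_0(k,\ell)$ such that for every $n\ge n_0$ a Berge-$K_{1,\ell}$-saturated $k$-uniform hypergraph on $n$ vertices exists and $$\mathrm{sat}_k(n,\text{Berge-}K_{1,\ell})=\min_{\substack{a\in[n]\\ \binom{a-1}{k-1}\le \max\{\ell-2,\,0\}}}\left(\left\lceil\frac{(\ell-1)(n-a)}{k}\right\rceil+\binom{a}{k}\right).$$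 (The maximum with $0$ matters only for $\ell=1$; for $\ell\ge 2$ the condition is $\binom{a-1}{k-1}\le \ell-2$.) -/

import Mathlib

open Filter

/-- A hypergraph on the vertex set `V` is given by its finite set of edges `H : Finset (Finset V)`.
It contains a Berge-`F` if there are an injective placement `ψ` of the vertices of `F` in `V` and an
injective assignment `φ` of edges of `H` to the edges of `F` such that the image under `ψ` of every
edge `s` of `F` is contained in the hyperedge `φ s`. -/
def ContainsBerge {V W : Type*} (F : SimpleGraph W) (H : Finset (Finset V)) : Prop :=
  ∃ (ψ : W ↪ V) (φ : F.edgeSet ↪ H), ∀ s : F.edgeSet, ∀ w ∈ s.val, ψ w ∈ (φ s).val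

/-- A `k`-uniform hypergraph `H` is Berge-`F`-saturated if it contains no Berge-`F`, but adding any
new `k`-element edge creates a Berge-`F`. -/
def IsBergeSaturated {V W : Type*} [DecidableEq V] (k : ℕ) (F : SimpleGraph W)
    (H : Finset (Finset V)) : Prop :=
  (∀ e ∈ H, e.card = k) ∧ ¬ ContainsBerge F H ∧
    ∀ e : Finset V, e.card = k → e ∉ H → ContainsBerge F (insert e H)

/-- The saturation number of Berge-`F`: the least number of edges of a `k`-uniform
Berge-`F`-saturated hypergraph on `n` vertices. -/
noncomputable def bergeSat {W : Type*} (k n : ℕ) (F : SimpleGraph W) : ℕ :=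
  sInf {m : ℕ | ∃ H : Finset (Finset (Fin n)), IsBergeSaturated k F H ∧ H.card = m}

/-- The star `K_{1,ℓ}` with `ℓ` leaves. -/
abbrev starK (ℓ : ℕ) : SimpleGraph (Fin 1 ⊕ Fin ℓ) :=
  completeBipartiteGraph (Fin 1) (Fin ℓ)

/-! For `ℓ = 1` the empty hypergraph is saturated, so let `ℓ ≥ 2`.

Lower bound: let `A` be the set of vertices of degree at most `ℓ - 2`. A star created by a new edge
is centered on that edge, at a vertex of degree at least `ℓ - 1`, so every `k`-subset of `A` is
already an edge. Hence `C(|A| - 1, k - 1) ≤ ℓ - 2` if `A` is nonempty, and counting degrees outside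
`A` bounds the number of edges not inside `A` (`IsBergeSaturated.exists_clique`).

Upper bound: take all `k`-subsets of `A` and a linear hypergraph that is `(ℓ - 1)`-regular outside
`A`; a single edge `f₀` may dip into `A` to repair divisibility by `k`. All degrees are at most `ℓ -
1`, so there is no star. A new edge has a vertex `v` outside `A`, and linearity at `v` supplies
distinct leaves (`exists_isBergeSaturated_starK`).

The regular linear hypergraph comes from a largest linear packing: while the total deficiency is at
least `k`, a switching gains one edge (`exists_regular_linearPacking`). -/

/-- The number of edges of `E` that contain the vertex `v`. -/
def edgeDegree {V : Type*} [DecidableEq V] (E : Finset (Finset V)) (v : V) : ℕ :=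
  (E.filter (fun e => v ∈ e)).card

/-- No edge of `E` meets both `X` and `Y`. -/
def FarApart {V : Type*} (E : Finset (Finset V)) (X Y : Finset V) : Prop :=
  ∀ h ∈ E, ∀ x ∈ h, x ∈ X → ∀ y ∈ h, y ∉ Y

/-- A linear `k`-uniform hypergraph of maximum degree at most `d` with a distinguished edge `f₀`,
all of whose other edges lie in `B`. -/
structure IsLinearPacking {V : Type*} [DecidableEq V] (k d : ℕ) (B f₀ : Finset V)
    (E : Finset (Finset V)) : Prop where
  mem : f₀ ∈ E
  card_eq : ∀ e ∈ E, e.card = k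
  subset : ∀ e ∈ E, e ≠ f₀ → e ⊆ B
  linear : ∀ e ∈ E, ∀ e' ∈ E, e ≠ e' → ∀ x ∈ e, x ∈ e' → ∀ y ∈ e, y ∈ e' → x = y
  degree_le : ∀ v, edgeDegree E v ≤ d

lemma FarApart.symm {V : Type*} {E : Finset (Finset V)} {X Y : Finset V} (h : FarApart E X Y) :
    FarApart E Y X :=
  fun e he y hy hyY x hx hxX => h e he x hx hxX y hy hyY

lemma FarApart.mono_left {V : Type*} {E : Finset (Finset V)} {X X' Y : Finset V} (h : FarApart E X Y)
    (hX : X' ⊆ X) : FarApart E X' Y :=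
  fun e he x hx hxX => h e he x hx (hX hxX)

/-! ### Degree counting and edges far apart. -/

section Degree
variable {V : Type*} [DecidableEq V]

lemma edgeDegree_eq_sum (E : Finset (Finset V)) (v : V) :
    edgeDegree E v = ∑ e ∈ E, if v ∈ e then 1 else 0 := by
  simp [edgeDegree]

lemma sum_edgeDegree (E : Finset (Finset V)) (B : Finset V) :
    ∑ v ∈ B, edgeDegree E v = ∑ e ∈ E, (e ∩ B).card := by
  simp only [edgeDegree_eq_sum]
  rw [Finset.sum_comm]
  refine Finset.sum_congr rfl fun e _ => ?_
  rw [← Finset.sum_filter, Finset.sum_const, smul_eq_mul, mul_one, Finset.filter_mem_eq_inter,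
    Finset.inter_comm]

lemma card_filter_not_disjoint_le {E : Finset (Finset V)} {d : ℕ}
    (hd : ∀ v, edgeDegree E v ≤ d) (X : Finset V) :
    (E.filter (fun e => ¬ Disjoint e X)).card ≤ d * X.card := by
  have hsub : E.filter (fun e => ¬ Disjoint e X) ⊆
      X.biUnion (fun x => E.filter (fun e => x ∈ e)) := by
    intro e he
    rw [Finset.mem_filter, Finset.not_disjoint_iff] at he
    obtain ⟨heE, x, hxe, hxX⟩ := he
    exact Finset.mem_biUnion.2 ⟨x, hxX, Finset.mem_filter.2 ⟨heE, hxe⟩⟩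
  refine (Finset.card_le_card hsub).trans ?_
  rw [mul_comm]
  exact Finset.card_biUnion_le_card_mul _ _ _ fun x _ => hd x

/-- Bounded degree makes the second neighbourhood of `X` small: at most `d * |X|` edges meet `X`,
and few edges meet their union `T`. Any edge missing `T` works. -/
lemma exists_farApart {E : Finset (Finset V)} {k d : ℕ} (hk : ∀ e ∈ E, e.card = k)
    (hd : ∀ v, edgeDegree E v ≤ d) (X : Finset V) (hX : d * (k * (d * X.card)) < E.card) :
    ∃ e ∈ E, FarApart E X e := by
  set T := (E.filter (fun e => ¬ Disjoint e X)).biUnion id with hT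
  have hTcard : T.card ≤ k * (d * X.card) := by
    rw [mul_comm k]
    refine (Finset.card_biUnion_le_card_mul _ _ k fun e he => ?_).trans
      (Nat.mul_le_mul_right _ (card_filter_not_disjoint_le hd X))
    exact (hk e (Finset.mem_filter.1 he).1).le
  have hlt : (E.filter (fun e => ¬ Disjoint e T)).card < E.card :=
    (card_filter_not_disjoint_le hd T).trans_lt ((Nat.mul_le_mul_left d hTcard).trans_lt hX)
  obtain ⟨e, heE, he⟩ : ∃ e ∈ E, Disjoint e T := by
    by_contra! hcon
    rw [Finset.filter_true_of_mem hcon] at hlt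
    exact lt_irrefl _ hlt
  refine ⟨e, heE, fun h hh x hx hxX y hy hye => Finset.disjoint_left.1 he hye ?_⟩
  exact Finset.mem_biUnion.2 ⟨h, Finset.mem_filter.2
    ⟨hh, Finset.not_disjoint_iff.2 ⟨x, hx, hxX⟩⟩, hy⟩

lemma exists_pairwise_farApart {E : Finset (Finset V)} {k d : ℕ} (hk : ∀ e ∈ E, e.card = k)
    (hd : ∀ v, edgeDegree E v ≤ d) (X : Finset V) (t : ℕ)
    (hX : d * (k * (d * (X.card + t * k))) < E.card) :
    ∃ f : ℕ → Finset V, ∀ j < t, f j ∈ E ∧ FarApart E X (f j) ∧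
      ∀ i < j, FarApart E (f i) (f j) := by
  induction t with
  | zero => exact ⟨fun _ => ∅, by simp⟩
  | succ t ih =>
    obtain ⟨f, hf⟩ := ih (lt_of_le_of_lt (by gcongr; omega) hX)
    set X' := X ∪ (Finset.range t).biUnion f with hX'
    have hcard : X'.card ≤ X.card + (t + 1) * k := by
      refine (Finset.card_union_le _ _).trans (Nat.add_le_add_left ?_ _)
      refine (Finset.card_biUnion_le_card_mul _ _ k fun j hj => ?_).trans ?_
      · exact (hk _ (hf j (Finset.mem_range.1 hj)).1).le
      · rw [Finset.card_range]; gcongr; omega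
    obtain ⟨e, heE, he⟩ := exists_farApart hk hd X' (lt_of_le_of_lt (by gcongr) hX)
    refine ⟨Function.update f t e, fun j hj => ?_⟩
    rcases Nat.lt_succ_iff_lt_or_eq.1 hj with hj | rfl
    · rw [Function.update_of_ne hj.ne]
      refine ⟨(hf j hj).1, (hf j hj).2.1, fun i hi => ?_⟩
      rw [Function.update_of_ne (hi.trans hj).ne]
      exact (hf j hj).2.2 i hi
    · rw [Function.update_self]
      refine ⟨heE, he.mono_left Finset.subset_union_left, fun i hi => ?_⟩
      rw [Function.update_of_ne hi.ne]
      exact he.mono_left ((Finset.subset_biUnion_of_mem f (Finset.mem_range.2 hi)).trans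
        Finset.subset_union_right)

end Degree

/-! ### Switchings and regular linear packings. -/

section Switching
variable {V : Type*} [DecidableEq V]

lemma IsLinearPacking.exists_card_succ_of_disjoint {k d : ℕ} {B f₀ g : Finset V}
    {E : Finset (Finset V)} (hE : IsLinearPacking k d B f₀ E) (hk : 0 < k) (hd : 0 < d)
    (hgB : g ⊆ B) (hg : g.card = k) (hdisj : ∀ e ∈ E, Disjoint e g) :
    ∃ E', IsLinearPacking k d B f₀ E' ∧ E'.card = E.card + 1 := by
  have hgE : g ∉ E := fun h => by
    have h0 := hdisj g h
    rw [disjoint_self, Finset.bot_eq_empty] at h0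
    rw [h0, Finset.card_empty] at hg
    omega
  refine ⟨insert g E, ⟨Finset.mem_insert_of_mem hE.mem, ?_, ?_, ?_, ?_⟩,
    Finset.card_insert_of_notMem hgE⟩
  · intro e he
    rcases Finset.mem_insert.1 he with rfl | he
    exacts [hg, hE.card_eq e he]
  · intro e he hne
    rcases Finset.mem_insert.1 he with rfl | he
    exacts [hgB, hE.subset e he hne]
  · intro e he e' he' hne x hx hx' y hy hy'
    rcases Finset.mem_insert.1 he with h | h <;> rcases Finset.mem_insert.1 he' with h' | h'
    · exact absurd (h.trans h'.symm) hne
    · exact absurd (h ▸ hx) (Finset.disjoint_left.1 (hdisj _ h') hx')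
    · exact absurd (h' ▸ hx') (Finset.disjoint_left.1 (hdisj _ h) hx)
    · exact hE.linear e h e' h' hne x hx hx' y hy hy'
  · intro u
    rw [edgeDegree_eq_sum, Finset.sum_insert hgE, ← edgeDegree_eq_sum]
    by_cases hu : u ∈ g
    · have : edgeDegree E u = 0 := by
        rw [edgeDegree, Finset.card_eq_zero, Finset.filter_eq_empty_iff]
        exact fun e he hue => Finset.disjoint_left.1 (hdisj e he) hue hu
      simp [hu, this]; omega
    · simpa [hu] using hE.degree_le u

/-- Write the `k - 1` edges `f j` as rows of a matrix with `k` columns. Replace the rows by the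
columns, adding `v i` to column `i`. Vertices of the matrix keep their degree and each `u` gains its
multiplicity in `v`, which need not be injective. Far-apartness preserves linearity. -/
lemma IsLinearPacking.exists_card_succ_of_farApart {k d : ℕ} {B f₀ : Finset V}
    {E : Finset (Finset V)} (hE : IsLinearPacking k d B f₀ E) (hk : 2 ≤ k)
    (v : Fin k → V) (hvB : ∀ i, v i ∈ B)
    (hv : ∀ u, edgeDegree E u + (Finset.univ.filter (fun i => v i = u)).card ≤ d)
    (f : Fin (k - 1) → Finset V) (hfE : ∀ j, f j ∈ E) (hf₀ : ∀ j, FarApart E f₀ (f j))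
    (hfv : ∀ i j, FarApart E {v i} (f j)) (hff : ∀ i j, i ≠ j → FarApart E (f i) (f j)) :
    ∃ E', IsLinearPacking k d B f₀ E' ∧ E'.card = E.card + 1 := by
  have hne : ∀ e ∈ E, e.Nonempty := fun e he => by
    rw [← Finset.card_pos, hE.card_eq e he]; omega
  have hdisj : ∀ i j, i ≠ j → Disjoint (f i) (f j) := fun i j hij =>
    Finset.disjoint_left.2 fun x hx => hff i j hij _ (hfE i) x hx hx x hx
  have hfinj : Function.Injective f := fun i j hij => by
    by_contra hne'
    have h0 := hdisj i j hne'
    rw [hij, disjoint_self, Finset.bot_eq_empty] at h0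
    exact (hne _ (hfE j)).ne_empty h0
  have hvf : ∀ i j, v i ∉ f j := fun i j h =>
    hfv i j _ (hfE j) _ h (Finset.mem_singleton_self _) _ h h
  have hf₀ne : ∀ j, f j ≠ f₀ := fun j h => by
    obtain ⟨x, hx⟩ := hne _ hE.mem
    exact hf₀ j _ hE.mem x hx hx x hx (h ▸ hx)
  have hx : ∀ j, ∃ x : Fin k → V, Function.Injective x ∧ ∀ u, u ∈ f j ↔ ∃ i, x i = u := by
    intro j
    have e := Finset.equivFinOfCardEq (hE.card_eq _ (hfE j))
    refine ⟨fun i => e.symm i, Subtype.val_injective.comp e.symm.injective, fun u => ?_⟩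
    constructor
    · exact fun hu => ⟨e ⟨u, hu⟩, by simp⟩
    · rintro ⟨i, rfl⟩
      exact (e.symm i).2
  choose x hxinj hxmem using hx
  have hxf : ∀ j i, x j i ∈ f j := fun j i => (hxmem j _).2 ⟨i, rfl⟩
  have hxx : ∀ j j' i i', x j i = x j' i' → j = j' ∧ i = i' := by
    intro j j' i i' h
    by_cases hj : j = j'
    · subst hj
      exact ⟨rfl, hxinj j h⟩
    · exact absurd (h ▸ hxf j' i') (Finset.disjoint_left.1 (hdisj j j' hj) (hxf j i))
  have hvx : ∀ i j i', v i ≠ x j i' := fun i j i' h => hvf i j (h ▸ hxf j i')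
  set g : Fin k → Finset V := fun i => insert (v i) (Finset.univ.image fun j => x j i) with hg
  have hgmem : ∀ i u, u ∈ g i ↔ u = v i ∨ ∃ j, x j i = u := fun i u => by simp [hg]
  have hgcard : ∀ i, (g i).card = k := by
    intro i
    rw [hg, Finset.card_insert_of_notMem, Finset.card_image_of_injective, Finset.card_univ,
      Fintype.card_fin]
    · omega
    · exact fun j j' h => (hxx _ _ _ _ h).1
    · simp only [Finset.mem_image, Finset.mem_univ, true_and, not_exists]
      exact fun j h => hvx i j i h.symm
  let j₀ : Fin (k - 1) := ⟨0, by omega⟩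
  have hginj : Function.Injective g := by
    intro i i' h
    have h1 : x j₀ i ∈ g i' := h ▸ (hgmem i _).2 (Or.inr ⟨j₀, rfl⟩)
    rcases (hgmem _ _).1 h1 with h1 | ⟨j, h1⟩
    · exact absurd h1.symm (hvx _ _ _)
    · exact (hxx _ _ _ _ h1).2.symm
  -- an edge of `E` outside the range of `f` meets each new edge in at most one vertex
  have holdnew : ∀ e ∈ E, (∀ j, f j ≠ e) → ∀ i, ∀ y ∈ e, y ∈ g i → ∀ z ∈ e, z ∈ g i → y = z := by
    intro e he hef i y hy hyg z hz hzg
    rcases (hgmem _ _).1 hyg with rfl | ⟨j, rfl⟩ <;> rcases (hgmem _ _).1 hzg with rfl | ⟨j', rfl⟩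
    · rfl
    · exact absurd (hxf j' i) (hfv i j' e he _ hy (Finset.mem_singleton_self _) _ hz)
    · exact absurd (hxf j i) (hfv i j e he _ hz (Finset.mem_singleton_self _) _ hy)
    · by_cases hj : j = j'
      · rw [hj]
      · exact absurd (hxf j' i) (hff j j' hj e he _ hy (hxf j i) _ hz)
  have hgE : ∀ i, g i ∉ E := fun i h =>
    hfv i j₀ _ h (v i) ((hgmem _ _).2 (Or.inl rfl)) (Finset.mem_singleton_self _) (x j₀ i)
      ((hgmem _ _).2 (Or.inr ⟨j₀, rfl⟩)) (hxf _ _)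
  have hFE : Finset.univ.image f ⊆ E := by
    intro e he
    obtain ⟨j, -, rfl⟩ := Finset.mem_image.1 he
    exact hfE j
  have hdisjG : Disjoint (E \ Finset.univ.image f) (Finset.univ.image g) := by
    refine Finset.disjoint_right.2 fun e he he' => ?_
    obtain ⟨i, -, rfl⟩ := Finset.mem_image.1 he
    exact hgE i (Finset.mem_sdiff.1 he').1
  have hmem : ∀ e, e ∈ (E \ Finset.univ.image f) ∪ Finset.univ.image g ↔
      (e ∈ E ∧ ∀ j, f j ≠ e) ∨ ∃ i, g i = e := by
    intro e; simp
  refine ⟨(E \ Finset.univ.image f) ∪ Finset.univ.image g, ⟨?_, ?_, ?_, ?_, ?_⟩, ?_⟩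
  · exact (hmem _).2 (Or.inl ⟨hE.mem, hf₀ne⟩)
  · intro e he
    rcases (hmem e).1 he with ⟨he, -⟩ | ⟨i, rfl⟩
    exacts [hE.card_eq e he, hgcard i]
  · intro e he hef
    rcases (hmem e).1 he with ⟨he, -⟩ | ⟨i, rfl⟩
    · exact hE.subset e he hef
    · intro u hu
      rcases (hgmem _ _).1 hu with rfl | ⟨j, rfl⟩
      · exact hvB i
      · exact hE.subset _ (hfE j) (hf₀ne j) (hxf j i)
  · intro e he e' he' hee y hy hy' z hz hz'
    rcases (hmem e).1 he with ⟨he, hef⟩ | ⟨i, rfl⟩ <;>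
      rcases (hmem e').1 he' with ⟨he', hef'⟩ | ⟨i', rfl⟩
    · exact hE.linear e he e' he' hee y hy hy' z hz hz'
    · exact holdnew e he hef i' y hy hy' z hz hz'
    · exact holdnew e' he' hef' i y hy' hy z hz' hz
    -- Distinct columns are disjoint, so two new edges can share only a repeated `v i`.
    · have key : ∀ w, w ∈ g i → w ∈ g i' → w = v i := by
        intro w hw hw'
        rcases (hgmem _ _).1 hw with rfl | ⟨j, rfl⟩
        · rfl
        · rcases (hgmem _ _).1 hw' with h | ⟨j', h⟩
          · exact absurd h.symm (hvx _ _ _)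
          · exact absurd (congrArg g (hxx _ _ _ _ h).2).symm hee
      rw [key y hy hy', key z hz hz']
  · intro u
    have hsumf : ∑ e ∈ Finset.univ.image f, (if u ∈ e then 1 else 0) =
        ∑ j, if u ∈ f j then 1 else 0 :=
      Finset.sum_image fun _ _ _ _ h => hfinj h
    have hsumg : ∑ e ∈ Finset.univ.image g, (if u ∈ e then 1 else 0) =
        ∑ i, if u ∈ g i then 1 else 0 :=
      Finset.sum_image fun _ _ _ _ h => hginj h
    have hgi : ∀ i, (if u ∈ g i then 1 else 0) =
        (if v i = u then 1 else 0) + ∑ j, if x j i = u then 1 else 0 := by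
      intro i
      by_cases h1 : v i = u
      · subst h1
        simp [hgmem, fun j => (hvx i j i).symm]
      · by_cases h2 : ∃ j, x j i = u
        · obtain ⟨j, rfl⟩ := h2
          have : ∀ j', x j' i = x j i ↔ j' = j :=
            fun j' => ⟨fun h => (hxx _ _ _ _ h).1, fun h => h ▸ rfl⟩
          simp [hgmem, h1, this]
        · have h3 : u ∉ g i := by
            rw [hgmem]; rintro (h | h)
            exacts [h1 h.symm, h2 h]
          push Not at h2
          simp [h1, h3, h2]
    have hfj : ∀ j, (∑ i, if x j i = u then 1 else 0) = if u ∈ f j then 1 else 0 := by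
      intro j
      by_cases h : u ∈ f j
      · obtain ⟨i, rfl⟩ := (hxmem j u).1 h
        simp [h, (hxinj j).eq_iff]
      · have : ∀ i, x j i ≠ u := fun i hi => h ((hxmem j u).2 ⟨i, hi⟩)
        simp [h, this]
    have hsplit := Finset.sum_sdiff (f := fun e => if u ∈ e then 1 else 0) hFE
    have hnew : ∑ i, (if u ∈ g i then 1 else 0) =
        (Finset.univ.filter (fun i => v i = u)).card + ∑ j, if u ∈ f j then 1 else 0 := by
      rw [Finset.sum_congr rfl fun i _ => hgi i, Finset.sum_add_distrib, Finset.sum_comm,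
        Finset.sum_congr rfl fun j _ => hfj j, Finset.card_filter]
    have hu := hv u
    rw [edgeDegree_eq_sum] at hu ⊢
    rw [Finset.sum_union hdisjG, hsumg, hnew]
    rw [hsumf] at hsplit
    omega
  · rw [Finset.card_union_of_disjoint hdisjG, Finset.card_sdiff_of_subset hFE,
      Finset.card_image_of_injective _ hfinj, Finset.card_image_of_injective _ hginj,
      Finset.card_univ, Finset.card_univ, Fintype.card_fin, Fintype.card_fin]
    have := Finset.card_le_card hFE
    rw [Finset.card_image_of_injective _ hfinj, Finset.card_univ, Fintype.card_fin] at this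
    omega

lemma exists_fin_map_of_le_sum (B : Finset V) (c : V → ℕ) (k : ℕ) (h : k ≤ ∑ u ∈ B, c u) :
    ∃ v : Fin k → V, (∀ i, v i ∈ B) ∧
      ∀ u, (Finset.univ.filter (fun i => v i = u)).card ≤ c u := by
  set S := B.sigma (fun u => Finset.range (c u)) with hS
  have hcard : k ≤ Fintype.card S := by
    rw [Fintype.card_coe, hS, Finset.card_sigma]; simpa using h
  obtain ⟨φ⟩ : Nonempty (Fin k ↪ S) :=
    Function.Embedding.nonempty_of_card_le (by rwa [Fintype.card_fin])
  refine ⟨fun i => (φ i).1.1, fun i => (Finset.mem_sigma.1 (φ i).2).1, fun u => ?_⟩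
  rw [← Finset.card_range (c u)]
  refine Finset.card_le_card_of_injOn (fun i => (φ i).1.2) ?_ ?_
  · intro i hi
    have hi' : (φ i).1.1 = u := (Finset.mem_filter.1 (Finset.mem_coe.1 hi)).2
    have := (Finset.mem_sigma.1 (φ i).2).2
    rw [hi'] at this
    exact this
  · intro i hi i' hi' hii
    have h1 : (φ i).1.1 = u := (Finset.mem_filter.1 (Finset.mem_coe.1 hi)).2
    have h2 : (φ i').1.1 = u := (Finset.mem_filter.1 (Finset.mem_coe.1 hi')).2
    exact φ.injective (Subtype.ext (Sigma.ext (h1.trans h2.symm) (heq_of_eq hii)))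

lemma IsLinearPacking.sum_edgeDegree_add {k d : ℕ} {B f₀ : Finset V}
    {E : Finset (Finset V)} (hE : IsLinearPacking k d B f₀ E) :
    ∑ u ∈ B, edgeDegree E u + (f₀ \ B).card = k * E.card := by
  rw [sum_edgeDegree, ← Finset.add_sum_erase _ _ hE.mem,
    Finset.sum_congr rfl (g := fun _ => k) fun e he => ?_, Finset.sum_const,
    Finset.card_erase_of_mem hE.mem, smul_eq_mul]
  · have h1 := Finset.card_inter_add_card_sdiff f₀ B
    have h2 : 0 < E.card := Finset.card_pos.2 ⟨_, hE.mem⟩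
    rw [hE.card_eq _ hE.mem] at h1
    obtain ⟨m, hm⟩ := Nat.exists_eq_add_of_lt h2
    rw [hm]
    simp only [zero_add, Nat.add_sub_cancel]
    nlinarith
  · obtain ⟨hne, he⟩ := Finset.mem_erase.1 he
    rw [Finset.inter_eq_left.2 (hE.subset e he hne), hE.card_eq e he]

/-- A number of vertices that suffices for linear packings to be extended to regular ones. -/
def packingBound (k d : ℕ) : ℕ := k * (d * (k * (d * (2 * k + k * k)))) + k

lemma IsLinearPacking.exists_card_succ {k d : ℕ} {B f₀ : Finset V}
    {E : Finset (Finset V)} (hE : IsLinearPacking k d B f₀ E) (hk : 2 ≤ k) (hd : 0 < d)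
    (hB : packingBound k d ≤ B.card) (hdef : k ≤ ∑ u ∈ B, (d - edgeDegree E u)) :
    ∃ E', IsLinearPacking k d B f₀ E' ∧ E'.card = E.card + 1 := by
  -- With few edges, `B` has `k` uncovered vertices, which form a new edge. With many, there is room
  -- for a switching: `2 * k` bounds the size of `f₀` together with the `v i`, and `k * k` that of
  -- the chosen rows.
  rcases le_or_gt E.card (d * (k * (d * (2 * k + k * k)))) with hle | hgt
  · have hU : (E.biUnion id).card ≤ k * (d * (k * (d * (2 * k + k * k)))) := by
      refine (Finset.card_biUnion_le_card_mul _ _ k fun e he => (hE.card_eq e he).le).trans ?_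
      rw [mul_comm]
      gcongr
    have hcard : k ≤ (B \ E.biUnion id).card := by
      have := Finset.le_card_sdiff (E.biUnion id) B
      unfold packingBound at hB
      omega
    obtain ⟨g, hg, hgk⟩ := Finset.exists_subset_card_eq hcard
    refine hE.exists_card_succ_of_disjoint (by omega) hd (hg.trans Finset.sdiff_subset) hgk ?_
    refine fun e he => Finset.disjoint_left.2 fun x hx hxg => ?_
    exact (Finset.mem_sdiff.1 (hg hxg)).2 (Finset.mem_biUnion.2 ⟨e, he, hx⟩)
  · obtain ⟨v, hvB, hv⟩ := exists_fin_map_of_le_sum B (fun u => d - edgeDegree E u) k hdef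
    have hX : (f₀ ∪ Finset.univ.image v).card ≤ 2 * k := by
      refine (Finset.card_union_le _ _).trans ?_
      have h1 : (Finset.univ.image v).card ≤ k := by
        simpa using Finset.card_image_le (s := Finset.univ) (f := v)
      rw [hE.card_eq _ hE.mem]
      omega
    obtain ⟨f, hf⟩ := exists_pairwise_farApart hE.card_eq hE.degree_le
      (f₀ ∪ Finset.univ.image v) (k - 1) (lt_of_le_of_lt (by gcongr; omega) hgt)
    refine hE.exists_card_succ_of_farApart hk v hvB (fun u => ?_) (fun j => f j)
      (fun j => (hf j j.2).1) (fun j => (hf j j.2).2.1.mono_left Finset.subset_union_left)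
      (fun i j => (hf j j.2).2.1.mono_left ?_) (fun i j hij => ?_)
    · have h1 := hv u
      have h2 := hE.degree_le u
      omega
    · rw [Finset.singleton_subset_iff]
      exact Finset.mem_union_right _ (Finset.mem_image_of_mem v (Finset.mem_univ i))
    · rcases lt_or_gt_of_ne (Fin.val_injective.ne hij) with h | h
      · exact (hf j j.2).2.2 i h
      · exact ((hf i i.2).2.2 j h).symm

/-- In a packing with the most edges the total deficiency on `B` is below `k`; the divisibility
hypothesis makes it a multiple of `k`, hence zero. -/
lemma exists_regular_linearPacking [Fintype V] {k d : ℕ} {B f₀ : Finset V} (hk : 2 ≤ k)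
    (hd : 0 < d) (hf₀ : f₀.card = k) (hB : packingBound k d ≤ B.card)
    (hdvd : k ∣ d * B.card + (f₀ \ B).card) :
    ∃ E, IsLinearPacking k d B f₀ E ∧ ∀ u ∈ B, edgeDegree E u = d := by
  classical
  have h0 : IsLinearPacking k d B f₀ {f₀} := by
    refine ⟨by simp, by simpa using hf₀, by simp, by simp +contextual, fun u => ?_⟩
    exact (Finset.card_filter_le _ _).trans (by simpa using Nat.succ_le_of_lt hd)
  obtain ⟨E, hE, hmax⟩ := Finset.exists_max_image
    (Finset.univ.filter fun E => IsLinearPacking k d B f₀ E) Finset.card ⟨_, by simpa using h0⟩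
  replace hE : IsLinearPacking k d B f₀ E := by simpa using hE
  refine ⟨E, hE, ?_⟩
  have hsum : ∑ u ∈ B, (d - edgeDegree E u) + ∑ u ∈ B, edgeDegree E u = d * B.card := by
    rw [← Finset.sum_add_distrib, Finset.sum_congr rfl
      fun u _ => Nat.sub_add_cancel (hE.degree_le u), Finset.sum_const, smul_eq_mul, mul_comm]
  have hadd := hE.sum_edgeDegree_add
  have hdvd' : k ∣ ∑ u ∈ B, (d - edgeDegree E u) := by
    refine (Nat.dvd_add_left (Dvd.intro E.card rfl : k ∣ k * E.card)).1 ?_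
    rwa [← hadd, ← add_assoc, hsum]
  have hzero : ∑ u ∈ B, (d - edgeDegree E u) = 0 := by
    by_contra hne
    obtain ⟨E', hE', hcard⟩ := hE.exists_card_succ hk hd hB
      (Nat.le_of_dvd (Nat.pos_of_ne_zero hne) hdvd')
    have := hmax E' (by simpa using hE')
    omega
  intro u hu
  have h1 := (Finset.sum_eq_zero_iff.1 hzero) u hu
  have h2 := hE.degree_le u
  omega

end Switching

/-! ### Berge stars and their centers. -/

section Star
variable {V : Type*}

lemma ContainsBerge.mono {W : Type*} {F : SimpleGraph W} {H H' : Finset (Finset V)} (h : H ⊆ H')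
    (hH : ContainsBerge F H) : ContainsBerge F H' := by
  obtain ⟨ψ, φ, hφ⟩ := hH
  exact ⟨ψ, φ.trans (Subtype.impEmbedding _ _ h), hφ⟩

lemma exists_eq_of_mem_edgeSet_starK {ℓ : ℕ} (s : (starK ℓ).edgeSet) :
    ∃ i : Fin ℓ, s.val = s(Sum.inl 0, Sum.inr i) := by
  obtain ⟨s, hs⟩ := s
  induction s using Sym2.ind with
  | _ x y =>
    rw [SimpleGraph.mem_edgeSet, completeBipartiteGraph_adj] at hs
    rcases x with x | x <;> rcases y with y | y <;> simp at hs
    · exact ⟨y, by rw [Subsingleton.elim x 0]⟩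
    · exact ⟨x, Sym2.eq_swap.trans (by rw [Subsingleton.elim y 0])⟩

/-- A system of distinct representatives for `ℓ` edges through `v` gives a Berge star. -/
lemma containsBerge_starK {ℓ : ℕ} {H S : Finset (Finset V)} {v : V} (hSH : S ⊆ H)
    (hcard : S.card = ℓ) (hv : ∀ s ∈ S, v ∈ s) (w : Finset V → V) (hw : ∀ s ∈ S, w s ∈ s)
    (hwv : ∀ s ∈ S, w s ≠ v) (hinj : Set.InjOn w S) : ContainsBerge (starK ℓ) H := by
  let e : S ≃ Fin ℓ := Finset.equivFinOfCardEq hcard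
  choose c hc using exists_eq_of_mem_edgeSet_starK (ℓ := ℓ)
  let ψ : Fin 1 ⊕ Fin ℓ → V := Sum.elim (fun _ => v) (fun i => w (e.symm i).1)
  refine ⟨⟨ψ, ?_⟩, ⟨fun s => ⟨(e.symm (c s)).1, hSH (e.symm (c s)).2⟩, ?_⟩, ?_⟩
  · rintro (x | x) (y | y) hxy
    · rw [Subsingleton.elim x y]
    · exact absurd hxy.symm (hwv _ (e.symm y).2)
    · exact absurd hxy (hwv _ (e.symm x).2)
    · exact congrArg Sum.inr
        (e.symm.injective (Subtype.ext (hinj (e.symm x).2 (e.symm y).2 hxy)))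
  · intro s t hst
    have h1 : c s = c t := e.symm.injective (Subtype.ext (Subtype.mk.inj hst))
    exact Subtype.ext (by rw [hc s, hc t, h1])
  · intro s x hx
    rw [hc s, Sym2.mem_iff] at hx
    rcases hx with rfl | rfl
    · exact hv _ (e.symm (c s)).2
    · exact hw _ (e.symm (c s)).2

variable [DecidableEq V]

lemma ContainsBerge.exists_center {ℓ : ℕ} {H : Finset (Finset V)}
    (h : ContainsBerge (starK ℓ) H) :
    ∃ v, ℓ ≤ edgeDegree H v ∧ ContainsBerge (starK ℓ) (H.filter (fun e => v ∈ e)) := by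
  obtain ⟨ψ, φ, hφ⟩ := h
  have hmem : ∀ s, ψ (Sum.inl 0) ∈ (φ s).val := by
    intro s
    obtain ⟨i, hi⟩ := exists_eq_of_mem_edgeSet_starK s
    exact hφ s _ (by rw [hi]; exact Sym2.mem_mk_left _ _)
  let φ' : (starK ℓ).edgeSet ↪ ↥(H.filter (fun e => ψ (Sum.inl 0) ∈ e)) :=
    ⟨fun s => ⟨(φ s).1, Finset.mem_filter.2 ⟨(φ s).2, hmem s⟩⟩, fun s t hst =>
      φ.injective (Subtype.ext (Subtype.mk.inj hst))⟩
  refine ⟨ψ (Sum.inl 0), ?_, ψ, φ', hφ⟩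
  let ι : Fin ℓ ↪ (starK ℓ).edgeSet :=
    ⟨fun i => ⟨s(Sum.inl 0, Sum.inr i), by simp⟩, fun i j hij => by simpa using hij⟩
  have := Fintype.card_le_of_embedding (ι.trans φ')
  rwa [Fintype.card_fin, Fintype.card_coe] at this

lemma edgeDegree_insert_le (H : Finset (Finset V)) (e : Finset V) (v : V) :
    edgeDegree (insert e H) v ≤ edgeDegree H v + 1 := by
  rw [edgeDegree, edgeDegree, Finset.filter_insert]
  split_ifs
  · exact Finset.card_insert_le _ _
  · omega

/-- If the center were off `e`, the star would use only edges of `H`. -/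
lemma exists_mem_of_containsBerge_insert {ℓ : ℕ} {H : Finset (Finset V)} {e : Finset V}
    (h : ¬ ContainsBerge (starK ℓ) H) (he : ContainsBerge (starK ℓ) (insert e H)) :
    ∃ v ∈ e, ℓ ≤ edgeDegree H v + 1 := by
  obtain ⟨v, hv, hv'⟩ := he.exists_center
  refine ⟨v, ?_, hv.trans (edgeDegree_insert_le H e v)⟩
  by_contra hve
  rw [Finset.filter_insert, if_neg hve] at hv'
  exact h (hv'.mono (Finset.filter_subset _ _))

/-- If the edges of `H` through `v` meet pairwise only in `v`, then adding another edge through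
`v` creates a Berge star centered at `v`. -/
lemma containsBerge_starK_insert {k d : ℕ} (hk : 3 ≤ k) {H : Finset (Finset V)} {e : Finset V}
    {v : V} (hdeg : edgeDegree H v = d) (hcard : ∀ s ∈ insert e H, s.card = k) (hve : v ∈ e)
    (heH : e ∉ H)
    (hlin : ∀ s ∈ H, v ∈ s → ∀ t ∈ H, v ∈ t → s ≠ t → ∀ x ∈ s, x ∈ t → x = v) :
    ContainsBerge (starK (d + 1)) (insert e H) := by
  obtain ⟨w₀, hw₀⟩ : (e.erase v).Nonempty := by
    rw [← Finset.card_pos, Finset.card_erase_of_mem hve, hcard e (Finset.mem_insert_self _ _)]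
    omega
  obtain ⟨hw₀v, hw₀e⟩ := Finset.mem_erase.1 hw₀
  -- `w₀` is the leaf for `e`, which may meet old edges outside `v`; the other leaves must avoid
  -- both `v` and `w₀`, hence `k ≥ 3`.
  have hex : ∀ s : Finset V, ∃ x, s ∈ H → v ∈ s → x ∈ s ∧ x ≠ v ∧ x ≠ w₀ := by
    intro s
    by_cases hs : s ∈ H
    · obtain ⟨x, hx⟩ : (s \ {v, w₀}).Nonempty := by
        rw [← Finset.card_pos]
        have h1 := Finset.le_card_sdiff {v, w₀} s
        have h2 := Finset.card_le_two (a := v) (b := w₀)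
        rw [hcard s (Finset.mem_insert_of_mem hs)] at h1
        omega
      refine ⟨x, fun _ _ => ?_⟩
      simpa using hx
    · exact ⟨v, fun h => absurd h hs⟩
  choose w hw using hex
  have hwe : ∀ s ∈ H, Function.update w e w₀ s = w s := fun s hs =>
    Function.update_of_ne (ne_of_mem_of_not_mem hs heH) _ _
  have hS : ∀ s, s ∈ insert e (H.filter (fun s => v ∈ s)) → s = e ∨ (s ∈ H ∧ v ∈ s) := by simp
  refine containsBerge_starK (S := insert e (H.filter (fun s => v ∈ s))) (v := v)
    (Finset.insert_subset_insert _ (Finset.filter_subset _ _)) ?_ ?_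
    (Function.update w e w₀) ?_ ?_ ?_
  · rw [Finset.card_insert_of_notMem fun h => heH (Finset.mem_filter.1 h).1]
    exact congrArg (· + 1) hdeg
  · intro s hs
    rcases hS s hs with rfl | ⟨-, hs⟩
    exacts [hve, hs]
  · intro s hs
    rcases hS s hs with rfl | ⟨hs, hvs⟩
    · rwa [Function.update_self]
    · rw [hwe s hs]; exact (hw s hs hvs).1
  · intro s hs
    rcases hS s hs with rfl | ⟨hs, hvs⟩
    · rwa [Function.update_self]
    · rw [hwe s hs]; exact (hw s hs hvs).2.1
  · intro s hs t ht hst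
    rcases hS s hs with h | ⟨hs, hvs⟩ <;> rcases hS t ht with h' | ⟨ht, hvt⟩
    · exact h.trans h'.symm
    · rw [h, Function.update_self, hwe t ht] at hst
      exact absurd hst.symm (hw t ht hvt).2.2
    · rw [h', Function.update_self, hwe s hs] at hst
      exact absurd hst (hw s hs hvs).2.2
    · rw [hwe s hs, hwe t ht] at hst
      by_contra hne
      exact (hw s hs hvs).2.1 (hlin s hs hvs t ht hvt hne _ (hw s hs hvs).1
        (hst ▸ (hw t ht hvt).1))

lemma edgeDegree_powersetCard {k : ℕ} (hk : 1 ≤ k) {A : Finset V} {v : V} (hv : v ∈ A) :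
    edgeDegree (A.powersetCard k) v = (A.card - 1).choose (k - 1) := by
  rw [← Finset.card_erase_of_mem hv, ← Finset.card_powersetCard, edgeDegree]
  refine Finset.card_bij' (fun s _ => s.erase v) (fun s _ => insert v s) ?_ ?_ ?_ ?_
  · intro s hs
    simp only [Finset.mem_filter, Finset.mem_powersetCard] at hs ⊢
    exact ⟨Finset.erase_subset_erase _ hs.1.1, by rw [Finset.card_erase_of_mem hs.2, hs.1.2]⟩
  · intro s hs
    simp only [Finset.mem_filter, Finset.mem_powersetCard] at hs ⊢
    have hvs : v ∉ s := fun h => Finset.notMem_erase v A (hs.1 h)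
    refine ⟨⟨Finset.insert_subset hv (hs.1.trans (Finset.erase_subset _ _)), ?_⟩,
      Finset.mem_insert_self _ _⟩
    rw [Finset.card_insert_of_notMem hvs, hs.2]
    omega
  · exact fun s hs => Finset.insert_erase (Finset.mem_filter.1 hs).2
  · exact fun s hs => Finset.erase_insert fun h =>
      Finset.notMem_erase v A ((Finset.mem_powersetCard.1 hs).1 h)

/-- The empty hypergraph is the saturated hypergraph for the star with a single edge. -/
lemma isBergeSaturated_starK_one {k : ℕ} (hk : 2 ≤ k) :
    IsBergeSaturated k (starK 1) (∅ : Finset (Finset V)) := by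
  refine ⟨by simp, fun h => ?_, fun e hek _ => ?_⟩
  · obtain ⟨v, hv, -⟩ := h.exists_center
    simp [edgeDegree] at hv
  · obtain ⟨x, hx, y, hy, hxy⟩ := Finset.one_lt_card.1 (show 1 < e.card by omega)
    refine containsBerge_starK (S := {e}) (v := x) (by simp) (by simp) (by simpa using hx)
      (fun _ => y) (by simpa using hy) (fun _ _ => hxy.symm) (by simp)

end Star

lemma starCeil_le_iff {k ℓ n a m : ℕ} (hk : 1 ≤ k) (hℓ : 1 ≤ ℓ) (ha : a ≤ n) :
    ⌈((ℓ : ℚ) - 1) * ((n : ℚ) - (a : ℚ)) / (k : ℚ)⌉₊ ≤ m ↔ (ℓ - 1) * (n - a) ≤ k * m := by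
  have hk' : (0 : ℚ) < k := by exact_mod_cast hk
  rw [Nat.ceil_le, div_le_iff₀ hk', mul_comm (m : ℚ)]
  have h1 : ((ℓ : ℚ) - 1) * ((n : ℚ) - (a : ℚ)) = (((ℓ - 1) * (n - a) : ℕ) : ℚ) := by
    push_cast [Nat.cast_sub hℓ, Nat.cast_sub ha]; ring
  rw [h1]
  exact_mod_cast Iff.rfl

/-! ### The two bounds for a given set `A`. -/

section Bounds
variable {V : Type*} [DecidableEq V] [Fintype V]

/-- The vertices of small degree in a saturated hypergraph span a complete hypergraph. -/
lemma IsBergeSaturated.exists_clique {k ℓ : ℕ} (hk : 1 ≤ k) (hℓ : 2 ≤ ℓ) {H : Finset (Finset V)}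
    (hH : IsBergeSaturated k (starK ℓ) H) :
    ∃ A : Finset V, (A.Nonempty → (A.card - 1).choose (k - 1) ≤ ℓ - 2) ∧
      ∃ m, (ℓ - 1) * (Fintype.card V - A.card) ≤ k * m ∧ m + A.card.choose k = H.card := by
  obtain ⟨huni, hfree, hsat⟩ := hH
  set A : Finset V := Finset.univ.filter (fun v => edgeDegree H v ≤ ℓ - 2) with hA
  have hsub : A.powersetCard k ⊆ H := by
    intro e he
    obtain ⟨heA, hek⟩ := Finset.mem_powersetCard.1 he
    by_contra heH
    obtain ⟨v, hve, hv⟩ := exists_mem_of_containsBerge_insert hfree (hsat e hek heH)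
    have := (Finset.mem_filter.1 (heA hve)).2
    omega
  refine ⟨A, ?_, (H \ A.powersetCard k).card, ?_, ?_⟩
  · rintro ⟨v, hv⟩
    rw [← edgeDegree_powersetCard hk hv]
    exact (Finset.card_le_card (Finset.filter_subset_filter _ hsub)).trans
      (Finset.mem_filter.1 hv).2
  · have h1 : (ℓ - 1) * (Fintype.card V - A.card) ≤ ∑ v ∈ Aᶜ, edgeDegree H v := by
      rw [← Finset.card_compl, mul_comm, ← smul_eq_mul]
      refine Finset.card_nsmul_le_sum _ _ _ fun v hv => ?_
      have : ¬ edgeDegree H v ≤ ℓ - 2 := by simpa [hA] using hv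
      omega
    refine h1.trans ?_
    rw [sum_edgeDegree, ← Finset.sum_sdiff hsub, mul_comm k, ← smul_eq_mul]
    -- Edges inside `A` contribute nothing to degrees outside `A`.
    rw [Finset.sum_eq_zero (s := A.powersetCard k), add_zero]
    · refine Finset.sum_le_card_nsmul _ _ _ fun e he => ?_
      exact (Finset.card_le_card Finset.inter_subset_left).trans
        (huni e (Finset.mem_sdiff.1 he).1).le
    · intro e he
      rw [Finset.card_eq_zero, ← Finset.disjoint_iff_inter_eq_empty]
      exact disjoint_compl_right.mono_left (Finset.mem_powersetCard.1 he).1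
  · rw [← Finset.card_powersetCard]
    exact Finset.card_sdiff_add_card_eq_card hsub

lemma exists_isBergeSaturated_starK {k ℓ m : ℕ} (hk : 3 ≤ k) (hℓ : 2 ≤ ℓ) {A : Finset V}
    (hA : k - 1 ≤ A.card) (hchoose : (A.card - 1).choose (k - 1) ≤ ℓ - 2)
    (hcard : packingBound k (ℓ - 1) ≤ Aᶜ.card) (hm : (ℓ - 1) * Aᶜ.card ≤ k * m)
    (hm' : k * m < (ℓ - 1) * Aᶜ.card + k) :
    ∃ H : Finset (Finset V), IsBergeSaturated k (starK ℓ) H ∧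
      H.card = m + A.card.choose k := by
  -- The edge `f₀ = R ∪ S` puts `r` vertices into `A` to absorb the rounding; `r < k` and `k - 1 ≤
  -- |A|` leave room for them.
  obtain ⟨r, hr⟩ := Nat.exists_eq_add_of_le hm
  have hrk : r < k := by omega
  obtain ⟨R, hRA, hR⟩ := Finset.exists_subset_card_eq (show r ≤ A.card by omega)
  obtain ⟨S, hSA, hS⟩ := Finset.exists_subset_card_eq
    (show k - r ≤ Aᶜ.card by unfold packingBound at hcard; omega)
  have hRS : Disjoint R S :=
    (disjoint_compl_right (a := A)).mono hRA hSA
  have hf₀ : (R ∪ S).card = k := by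
    rw [Finset.card_union_of_disjoint hRS]; omega
  have hsd : (R ∪ S) \ Aᶜ = R := by
    rw [Finset.union_sdiff_distrib, Finset.sdiff_eq_empty_iff_subset.2 hSA, Finset.union_empty,
      sdiff_compl]
    exact Finset.inter_eq_left.2 hRA
  obtain ⟨E, hE, hreg⟩ := exists_regular_linearPacking (d := ℓ - 1) (B := Aᶜ) (by omega)
    (by omega) hf₀ hcard (by rw [hsd, hR, ← hr]; exact Dvd.intro m rfl)
  have hEcard : E.card = m := by
    have h1 := hE.sum_edgeDegree_add
    rw [Finset.sum_congr rfl hreg, Finset.sum_const, smul_eq_mul, hsd, hR, mul_comm, ← hr] at h1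
    exact (Nat.eq_of_mul_eq_mul_left (by omega) h1).symm
  have hEA : ∀ e ∈ E, ∃ x ∈ e, x ∉ A := by
    intro e he
    by_cases hef : e = R ∪ S
    · obtain ⟨x, hx⟩ : S.Nonempty := by rw [← Finset.card_pos]; omega
      exact ⟨x, hef ▸ Finset.mem_union_right _ hx, Finset.mem_compl.1 (hSA hx)⟩
    · obtain ⟨x, hx⟩ : e.Nonempty := by rw [← Finset.card_pos, hE.card_eq e he]; omega
      exact ⟨x, hx, Finset.mem_compl.1 (hE.subset e he hef hx)⟩
  have hdisj : Disjoint E (A.powersetCard k) := by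
    refine Finset.disjoint_left.2 fun e he he' => ?_
    obtain ⟨x, hx, hxA⟩ := hEA e he
    exact hxA ((Finset.mem_powersetCard.1 he').1 hx)
  have hfilter : ∀ v ∉ A, (A.powersetCard k).filter (fun e => v ∈ e) = ∅ := fun v hv =>
    Finset.filter_eq_empty_iff.2 fun e he hve => hv ((Finset.mem_powersetCard.1 he).1 hve)
  have hdegB : ∀ v ∉ A, edgeDegree (E ∪ A.powersetCard k) v = ℓ - 1 := by
    intro v hv
    rw [edgeDegree, Finset.filter_union, hfilter v hv, Finset.union_empty]
    exact hreg v (Finset.mem_compl.2 hv)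
  -- In `A` the clique gives at most `ℓ - 2`, and only `f₀` can add one more.
  have hdeg : ∀ v, edgeDegree (E ∪ A.powersetCard k) v ≤ ℓ - 1 := by
    intro v
    by_cases hv : v ∈ A
    · have h1 : edgeDegree E v ≤ 1 := by
        rw [edgeDegree, Finset.card_le_one]
        have key : ∀ e ∈ E.filter (fun e => v ∈ e), e = R ∪ S := by
          intro e he
          obtain ⟨he, hve⟩ := Finset.mem_filter.1 he
          by_contra hne
          exact Finset.mem_compl.1 (hE.subset e he hne hve) hv
        exact fun e he e' he' => (key e he).trans (key e' he').symm
      have h2 := edgeDegree_powersetCard (k := k) (by omega) hv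
      rw [edgeDegree] at h1 h2 ⊢
      rw [Finset.filter_union]
      have := Finset.card_union_le (E.filter (fun e => v ∈ e))
        ((A.powersetCard k).filter (fun e => v ∈ e))
      omega
    · exact (hdegB v hv).le
  have huni : ∀ e ∈ E ∪ A.powersetCard k, e.card = k := by
    intro e he
    rcases Finset.mem_union.1 he with he | he
    exacts [hE.card_eq e he, (Finset.mem_powersetCard.1 he).2]
  refine ⟨E ∪ A.powersetCard k, ⟨huni, fun h => ?_, fun e hek heH => ?_⟩, ?_⟩
  · obtain ⟨v, hv, -⟩ := h.exists_center
    have := hdeg v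
    omega
  · obtain ⟨v, hve, hvA⟩ : ∃ v ∈ e, v ∉ A := by
      by_contra! hcon
      exact heH (Finset.mem_union_right _ (Finset.mem_powersetCard.2 ⟨hcon, hek⟩))
    have hmemE : ∀ s ∈ E ∪ A.powersetCard k, v ∈ s → s ∈ E := by
      intro s hs hvs
      rcases Finset.mem_union.1 hs with hs | hs
      · exact hs
      · exact absurd ((Finset.mem_powersetCard.1 hs).1 hvs) hvA
    have := containsBerge_starK_insert hk (hdegB v hvA)
      (Finset.forall_mem_insert .. |>.2 ⟨hek, huni⟩) hve heH fun s hs hvs t ht hvt hne x hx hx' =>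
        hE.linear s (hmemE s hs hvs) t (hmemE t ht hvt) hne x hx hx' v hvs hvt
    rwa [Nat.sub_add_cancel (by omega)] at this
  · rw [Finset.card_union_of_disjoint hdisj, hEcard, Finset.card_powersetCard]

end Bounds

/-! ### Optimizing over `a`. -/

lemma lt_choose_add (q j : ℕ) (hq : 1 ≤ q) : j < (q + j).choose q := by
  induction j with
  | zero => simp
  | succ j ih =>
    obtain ⟨p, rfl⟩ := Nat.exists_eq_add_of_le' hq
    have h1 : 0 < (p + 1 + j).choose p := Nat.choose_pos (by omega)
    have h2 : (p + 1 + (j + 1)).choose (p + 1) =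
      (p + 1 + j).choose p + (p + 1 + j).choose (p + 1) := Nat.choose_succ_succ _ _
    omega

lemma exists_isBergeSaturated_starK_card_le {k ℓ n a : ℕ} (hk : 3 ≤ k) (hℓ : 1 ≤ ℓ)
    (hn : packingBound k (ℓ - 1) + k + ℓ ≤ n) (ha : a ≤ n)
    (hchoose : (((a - 1).choose (k - 1) : ℕ) : ℤ) ≤ max ((ℓ : ℤ) - 2) 0) :
    ∃ H : Finset (Finset (Fin n)), IsBergeSaturated k (starK ℓ) H ∧
      H.card ≤ ⌈((ℓ : ℚ) - 1) * ((n : ℚ) - (a : ℚ)) / (k : ℚ)⌉₊ + a.choose k := by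
  rcases hℓ.eq_or_lt with rfl | hℓ2
  · exact ⟨∅, isBergeSaturated_starK_one (by omega), by simp⟩
  have hchoose' : (a - 1).choose (k - 1) ≤ ℓ - 2 := by omega
  -- The construction needs `k - 1` vertices in `A`. Raising a smaller `a` to `k - 1` keeps both
  -- binomials zero and cannot increase the ceiling.
  set b := max a (k - 1) with hb
  have hbchoose : (b - 1).choose (k - 1) ≤ ℓ - 2 := by
    rcases le_total (k - 1) a with h | h
    · rwa [hb, max_eq_left h]
    · rw [hb, max_eq_right h, Nat.choose_eq_zero_of_lt (by omega)]
      omega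
  have hbk : b.choose k = a.choose k := by
    rcases le_total (k - 1) a with h | h
    · rw [hb, max_eq_left h]
    · rw [hb, max_eq_right h, Nat.choose_eq_zero_of_lt (by omega : k - 1 < k),
        Nat.choose_eq_zero_of_lt (by omega : a < k)]
  -- Bounds `b` independently of `n`, so that the complement of `A` is large.
  have hble : b < k + ℓ := by
    by_contra! hcon
    have h1 := lt_choose_add (k - 1) ℓ (by omega)
    have h2 := Nat.choose_le_choose (k - 1) (show k - 1 + ℓ ≤ b - 1 by omega)
    omega
  obtain ⟨A, -, hA⟩ := Finset.exists_subset_card_eq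
    (show b ≤ (Finset.univ : Finset (Fin n)).card by rw [Finset.card_univ, Fintype.card_fin]; omega)
  have hAc : Aᶜ.card = n - b := by rw [Finset.card_compl, hA, Fintype.card_fin]
  set m := ⌈((ℓ : ℚ) - 1) * ((n : ℚ) - (b : ℚ)) / (k : ℚ)⌉₊ with hm
  have hmle := (starCeil_le_iff (k := k) (ℓ := ℓ) (n := n) (a := b) (m := m) (by omega) hℓ
    (by omega)).1 le_rfl
  have hmlt : k * m < (ℓ - 1) * (n - b) + k := by
    rcases Nat.eq_zero_or_pos m with h0 | h0
    · rw [h0]; omega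
    · have h1 : ¬ (ℓ - 1) * (n - b) ≤ k * (m - 1) := by
        rw [← starCeil_le_iff (by omega) hℓ (by omega), ← hm]; omega
      obtain ⟨m', hm'⟩ := Nat.exists_eq_add_of_le' h0
      rw [hm'] at h1 ⊢
      rw [Nat.add_sub_cancel] at h1
      rw [mul_add]
      omega
  obtain ⟨H, hH, hcard⟩ := exists_isBergeSaturated_starK (m := m) hk hℓ2 (A := A) (by omega)
    (by rwa [hA]) (by rw [hAc]; omega) (by rwa [hAc]) (by rwa [hAc])
  refine ⟨H, hH, ?_⟩
  rw [hcard, hA, hbk]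
  refine Nat.add_le_add_right ?_ _
  rw [hm, starCeil_le_iff (by omega) hℓ (by omega)]
  refine le_trans ?_ ((starCeil_le_iff (k := k) (by omega) hℓ ha).1 le_rfl)
  gcongr
  omega

lemma IsBergeSaturated.exists_le_card {k ℓ n : ℕ} (hk : 2 ≤ k) (hℓ : 1 ≤ ℓ) (hn : 1 ≤ n)
    {H : Finset (Finset (Fin n))} (hH : IsBergeSaturated k (starK ℓ) H) :
    ∃ a ∈ Finset.Icc 1 n, (((a - 1).choose (k - 1) : ℕ) : ℤ) ≤ max ((ℓ : ℤ) - 2) 0 ∧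
      ⌈((ℓ : ℚ) - 1) * ((n : ℚ) - (a : ℚ)) / (k : ℚ)⌉₊ + a.choose k ≤ H.card := by
  have hone : ((1 - 1).choose (k - 1) : ℕ) = 0 := Nat.choose_eq_zero_of_lt (by omega)
  have hone' : (1 : ℕ).choose k = 0 := Nat.choose_eq_zero_of_lt (by omega)
  rcases hℓ.eq_or_lt with rfl | hℓ2
  · exact ⟨1, Finset.mem_Icc.2 ⟨le_rfl, hn⟩, by rw [hone]; simp, by rw [hone']; simp⟩
  obtain ⟨A, hA, m, hm, hcard⟩ := hH.exists_clique (by omega) hℓ2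
  rw [Fintype.card_fin] at hm
  rcases A.eq_empty_or_nonempty with rfl | hne
  -- The minimum starts at `a = 1`, which is always admissible and costs no more than `a = 0`.
  · refine ⟨1, Finset.mem_Icc.2 ⟨le_rfl, hn⟩, by rw [hone]; simp, ?_⟩
    rw [hone', add_zero]
    refine le_trans ?_ (hcard ▸ Nat.le_add_right m _)
    rw [starCeil_le_iff (by omega) hℓ hn]
    refine le_trans ?_ hm
    gcongr
    simp
  · have hAn : A.card ≤ n := by simpa using Finset.card_le_univ A
    refine ⟨A.card, Finset.mem_Icc.2 ⟨hne.card_pos, hAn⟩, ?_, ?_⟩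
    · have := hA hne
      omega
    · rw [← hcard]
      exact Nat.add_le_add_right ((starCeil_le_iff (by omega) hℓ hAn).2 hm) _

theorem theorem1p4 (k ℓ : ℕ) (hk : 3 ≤ k) (hℓ : 1 ≤ ℓ) :
    ∀ᶠ n : ℕ in atTop,
      (∃ H : Finset (Finset (Fin n)), IsBergeSaturated k (starK ℓ) H) ∧
      IsLeast
        {m : ℕ | ∃ a ∈ Finset.Icc 1 n,
          (((a - 1).choose (k - 1) : ℕ) : ℤ) ≤ max ((ℓ : ℤ) - 2) 0 ∧
          m = ⌈((ℓ : ℚ) - 1) * ((n : ℚ) - (a : ℚ)) / (k : ℚ)⌉₊ + a.choose k}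
        (bergeSat k n (starK ℓ)) := by
  filter_upwards [eventually_ge_atTop (packingBound k (ℓ - 1) + k + ℓ)] with n hn
  have hone : ((1 - 1).choose (k - 1) : ℕ) = 0 := Nat.choose_eq_zero_of_lt (by omega)
  obtain ⟨H₁, hH₁, -⟩ := exists_isBergeSaturated_starK_card_le hk hℓ hn
    (show 1 ≤ n by omega) (by rw [hone]; simp)
  have hlow : ∀ a ∈ Finset.Icc 1 n,
      (((a - 1).choose (k - 1) : ℕ) : ℤ) ≤ max ((ℓ : ℤ) - 2) 0 → bergeSat k n (starK ℓ) ≤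
        ⌈((ℓ : ℚ) - 1) * ((n : ℚ) - (a : ℚ)) / (k : ℚ)⌉₊ + a.choose k := by
    intro a ha hchoose
    obtain ⟨H, hH, hcard⟩ := exists_isBergeSaturated_starK_card_le hk hℓ hn
      (Finset.mem_Icc.1 ha).2 hchoose
    have hmem : H.card ∈ {m : ℕ | ∃ H : Finset (Finset (Fin n)),
        IsBergeSaturated k (starK ℓ) H ∧ H.card = m} := ⟨H, hH, rfl⟩
    exact (Nat.sInf_le hmem).trans hcard
  refine ⟨⟨H₁, hH₁⟩, ?_, ?_⟩
  -- Nonemptiness ensures that `sInf` is attained and is not the default value `0`.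
  · have hne : {m : ℕ | ∃ H : Finset (Finset (Fin n)),
        IsBergeSaturated k (starK ℓ) H ∧ H.card = m}.Nonempty := ⟨H₁.card, H₁, hH₁, rfl⟩
    obtain ⟨H, hH, hcard⟩ := Nat.sInf_mem hne
    obtain ⟨a, ha, hchoose, hle⟩ := hH.exists_le_card (by omega) hℓ (by omega)
    exact ⟨a, ha, hchoose, le_antisymm (hlow a ha hchoose) (hle.trans hcard.le)⟩
  · rintro m ⟨a, ha, hchoose, rfl⟩
    exact hlow a ha hchoose
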